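/- Let $G$ be a finitely generated group and let $K$ be a field that is quadratically closed, i.e. every equation $x^2+ax+b=0$ with $a,b\in K$ has a root in $K$. Let $X_K(G)$ be the set of all $SL(2,K)$ characters on $G$, i.e. of all functions $\chi_\rho\colon G\to K$, $\chi_\rho(g)=\operatorname{tr}\rho(g)$, where $\rho\colon G\to SL(2,K)$ is a homomorphism. Then $X_K(G)$ is an affine algebraic variety (not necessarily irreducible) defined over $K$ by polynomial equations with integer coefficients, in the following sense. There are a finite subset $F\subset G$ and a finite set $S\subset\mathbb{Z}[t_x : x\in F]$ such that the restriction map $\chi\mapsto\chi|_F$ is a bijection from $X_K(G)$ onto $$\{t\in K^F : p(t)=0 \text{ for all } p\in S\},$$ and for every $g\in G$ there is a polynomial $P_g\in\mathbb{Z}[t_x : x\in F]$ with $\chi(g)=P_g(\chi|_F)$ for all $\chi\in X_K(G)$. -/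

import Mathlib

/-- `K` is quadratically closed: each equation `x ^ 2 + a x + b = 0` over `K` has a root in `K`. -/
def IsQuadraticallyClosed (K : Type*) [Field K] : Prop :=
  ∀ a b : K, ∃ x : K, x ^ 2 + a * x + b = 0

/-- The character `g ↦ tr (ρ g)` of a representation `ρ` of `G` to `SL(2, K)`. -/
def sl2Character {G K : Type*} [Group G] [Field K]
    (ρ : G →* Matrix.SpecialLinearGroup (Fin 2) K) : G → K :=
  fun g => Matrix.trace (ρ g : Matrix (Fin 2) (Fin 2) K)

/-- The set of all `SL(2, K)` characters on `G`, as a set of functions `G → K`. -/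
def characterVariety (G K : Type*) [Group G] [Field K] : Set (G → K) :=
  {χ | ∃ ρ : G →* Matrix.SpecialLinearGroup (Fin 2) K, sl2Character ρ = χ}

/-- The restriction of a function on `G` to a finite subset `F`, as a point of the affine
space `K ^ F`. -/
def restrictTo {G K : Type*} (F : Finset G) (χ : G → K) : F → K :=
  fun x => χ x

/-- The affine algebraic set in `K ^ σ` cut out by a finite set `S` of polynomials with integer
coefficients. -/
def integralZeroSet {σ : Type*} (K : Type*) [Field K] (S : Finset (MvPolynomial σ ℤ)) :
    Set (σ → K) :=
  {t | ∀ p ∈ S, MvPolynomial.aeval t p = 0}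

/-! Characters satisfy τ(1) = 2 and τ(gh) + τ(gh⁻¹) = τ(g)τ(h), and over a quadratically closed
field these identities characterise them (`IsTraceFunction.mem_characterVariety`): on K[G], a g with
τ(g)² ≠ 4 has two distinct eigenvalues, whose spectral projections yield the matrix entries of a
representation. If no such g exists, τ is twice a sign character.

The identities also make every value of τ an integral polynomial in finitely many values
(`exists_finset_forall_mem_adjoin`), since Cayley–Hamilton and its polarisation reduce words to
ordered products of distinct generators. Substituting these polynomials into the identities gives
equations for the variety, and Hilbert's basis theorem leaves finitely many. -/

/-- A function `τ` on a group satisfying the fundamental trace identities of `SL(2)`. -/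
structure IsTraceFunction {G R : Type*} [Group G] [CommRing R] (τ : G → R) : Prop where
  map_one : τ 1 = 2
  map_mul_add : ∀ g h, τ (g * h) + τ (g * h⁻¹) = τ g * τ h

namespace IsTraceFunction

variable {G R : Type*} [Group G] [CommRing R] {τ : G → R}

lemma map_inv (hτ : IsTraceFunction τ) (g : G) : τ g⁻¹ = τ g := by
  have h := hτ.map_mul_add 1 g
  rw [one_mul, one_mul, hτ.map_one] at h
  linear_combination h

lemma map_mul_comm (hτ : IsTraceFunction τ) (g h : G) : τ (g * h) = τ (h * g) := by
  have h₁ := hτ.map_mul_add g h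
  have h₂ := hτ.map_mul_add h g
  have h₃ := hτ.map_inv (g * h⁻¹)
  rw [mul_inv_rev, inv_inv] at h₃
  linear_combination h₁ - h₂ + h₃

end IsTraceFunction

/-! ### Finite generation of the ring of trace values -/

section FiniteGeneration

variable {G C : Type*} [Group G] [CommRing C]

/-- The functions on `G` satisfying the trace identity with respect to `τ` in every middle factor. -/
def SatisfiesTraceIdentity (τ ψ : G → C) : Prop :=
  ∀ x s y, ψ (x * s * y) + ψ (x * s⁻¹ * y) = τ s * ψ (x * y)

lemma IsTraceFunction.satisfiesTraceIdentity {τ : G → C} (hτ : IsTraceFunction τ) (g : G) :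
    SatisfiesTraceIdentity τ (fun x => τ (x * g)) := by
  intro x s y
  have h := hτ.map_mul_add (y * g * x) s
  have h₁ := hτ.map_mul_comm (y * g) (x * s)
  have h₂ := hτ.map_mul_comm (y * g) (x * s⁻¹)
  have h₃ := hτ.map_mul_comm (y * g) x
  simp only [mul_assoc] at *
  rw [← h₁, ← h₂, ← h₃, h, mul_comm]

/-- Right translation of functions on a group, as a linear map over a ring of scalars. -/
def rightTranslation (L : Subring C) (a : G) : (G → C) →ₗ[L] (G → C) :=
  LinearMap.funLeft L C (· * a)

@[simp] lemma rightTranslation_apply (L : Subring C) (a : G) (ψ : G → C) (x : G) :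
    rightTranslation L a ψ x = ψ (x * a) := rfl

/-- The span of the translates of `τ` by the ordered products of sublists of a list. -/
def orderedSpan (L : Subring C) (τ : G → C) : List G → Submodule L (G → C)
  | [] => Submodule.span L {τ}
  | a :: l => orderedSpan L τ l ⊔ (orderedSpan L τ l).map (rightTranslation L a)

lemma mem_orderedSpan_cons {L : Subring C} {τ : G → C} {a : G} {l : List G} {ψ : G → C} :
    ψ ∈ orderedSpan L τ (a :: l) ↔ ∃ φ₁ ∈ orderedSpan L τ l, ∃ φ₂ ∈ orderedSpan L τ l,
      φ₁ + rightTranslation L a φ₂ = ψ := by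
  simp [orderedSpan, Submodule.mem_sup]

lemma self_mem_orderedSpan (L : Subring C) (τ : G → C) (l : List G) : τ ∈ orderedSpan L τ l := by
  induction l with
  | nil => exact Submodule.mem_span_singleton_self τ
  | cons a l ih => exact Submodule.mem_sup_left ih

/-- The free right factor `y` in the identity absorbs right translations. -/
lemma IsTraceFunction.satisfiesTraceIdentity_of_mem_orderedSpan {τ : G → C}
    (hτ : IsTraceFunction τ) (L : Subring C) {l : List G} {ψ : G → C}
    (hψ : ψ ∈ orderedSpan L τ l) : SatisfiesTraceIdentity τ ψ := by
  induction l generalizing ψ with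
  | nil =>
    obtain ⟨c, rfl⟩ := Submodule.mem_span_singleton.1 hψ
    intro x s y
    have h := hτ.satisfiesTraceIdentity 1 x s y
    simp only [mul_one] at h
    simp only [Pi.smul_apply, Subring.smul_def, smul_eq_mul]
    linear_combination (c : C) * h
  | cons a l ih =>
    obtain ⟨φ₁, h₁, φ₂, h₂, rfl⟩ := mem_orderedSpan_cons.1 hψ
    intro x s y
    have h₃ := ih h₁ x s y
    have h₄ := ih h₂ x s (y * a)
    simp only [Pi.add_apply, rightTranslation_apply, mul_assoc] at *
    linear_combination h₃ + h₄

lemma SatisfiesTraceIdentity.translate_self {τ ψ : G → C} (hψ : SatisfiesTraceIdentity τ ψ)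
    (a x : G) : ψ (x * a * a) = τ a * ψ (x * a) - ψ x := by
  have h := hψ x a a
  rw [inv_mul_cancel_right] at h
  linear_combination h

lemma SatisfiesTraceIdentity.translate_inv {τ ψ : G → C} (hψ : SatisfiesTraceIdentity τ ψ)
    (a x : G) : ψ (x * a⁻¹) = τ a * ψ x - ψ (x * a) := by
  have h := hψ x a 1
  simp only [mul_one] at h
  linear_combination h

/-- Polarised Cayley–Hamilton: it exchanges two adjacent generators modulo shorter words. -/
lemma SatisfiesTraceIdentity.translate_swap {τ ψ : G → C} (hψ : SatisfiesTraceIdentity τ ψ)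
    (s a x : G) : ψ (x * s * a) =
      (τ (s * a) - τ s * τ a) * ψ x + τ a * ψ (x * s) + τ s * ψ (x * a) - ψ (x * a * s) := by
  have h₁ := hψ.translate_inv (s * a) x
  have h₂ := hψ x a s⁻¹
  have h₃ := hψ.translate_inv s x
  have h₄ := hψ.translate_inv s (x * a)
  rw [mul_inv_rev] at h₁
  simp only [mul_assoc] at *
  linear_combination h₁ - h₂ - τ a * h₃ + h₄

/-- A letter equal to the head `a` is absorbed by `translate_self`; any other is moved past `a` by
`translate_swap` and handled in the tail. The coefficients involve only traces of generators and of
their pairwise products. -/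
lemma IsTraceFunction.rightTranslation_mem_orderedSpan {τ : G → C} (hτ : IsTraceFunction τ)
    {L : Subring C} {l : List G} (h₁ : ∀ a ∈ l, τ a ∈ L)
    (h₂ : ∀ a ∈ l, ∀ b ∈ l, τ (a * b) ∈ L) {s : G} (hs : s ∈ l) {ψ : G → C}
    (hψ : ψ ∈ orderedSpan L τ l) : rightTranslation L s ψ ∈ orderedSpan L τ l := by
  induction l generalizing s ψ with
  | nil => simp at hs
  | cons a l ih =>
    have ih' : ∀ {s : G}, s ∈ l → ∀ {ψ : G → C}, ψ ∈ orderedSpan L τ l →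
        rightTranslation L s ψ ∈ orderedSpan L τ l :=
      fun hs _ hψ => ih (fun b hb => h₁ b (List.mem_cons_of_mem a hb))
        (fun b hb c hc => h₂ b (List.mem_cons_of_mem a hb) c (List.mem_cons_of_mem a hc)) hs hψ
    obtain ⟨φ₁, hφ₁, φ₂, hφ₂, rfl⟩ := mem_orderedSpan_cons.1 hψ
    have hid := hτ.satisfiesTraceIdentity_of_mem_orderedSpan L hφ₂
    have ha := h₁ a List.mem_cons_self
    rw [mem_orderedSpan_cons]
    by_cases hsa : s = a
    · subst hsa
      refine ⟨-φ₂, neg_mem hφ₂, φ₁ + (⟨τ s, ha⟩ : L) • φ₂,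
        add_mem hφ₁ (Submodule.smul_mem _ _ hφ₂), ?_⟩
      ext x
      have h := hid.translate_self s x
      simp only [map_add, Pi.add_apply, Pi.neg_apply, Pi.smul_apply,
        rightTranslation_apply, Subring.smul_def, smul_eq_mul] at *
      linear_combination -h
    · have hsl : s ∈ l := (List.mem_cons.1 hs).resolve_left hsa
      have hs' := h₁ s hs
      refine ⟨rightTranslation L s φ₁ +
          ((⟨τ (s * a), h₂ s hs a List.mem_cons_self⟩ - ⟨τ s, hs'⟩ * ⟨τ a, ha⟩ : L) • φ₂ +
            (⟨τ a, ha⟩ : L) • rightTranslation L s φ₂),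
        add_mem (ih' hsl hφ₁) (add_mem (Submodule.smul_mem _ _ hφ₂)
          (Submodule.smul_mem _ _ (ih' hsl hφ₂))),
        (⟨τ s, hs'⟩ : L) • φ₂ - rightTranslation L s φ₂,
        sub_mem (Submodule.smul_mem _ _ hφ₂) (ih' hsl hφ₂), ?_⟩
      ext x
      have h := hid.translate_swap s a x
      have hcoe : ((⟨τ (s * a), h₂ s hs a List.mem_cons_self⟩ - ⟨τ s, hs'⟩ * ⟨τ a, ha⟩ : L) : C) =
        τ (s * a) - τ s * τ a := rfl
      simp only [map_sub, Pi.add_apply, Pi.sub_apply, Pi.smul_apply,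
        rightTranslation_apply, Subring.smul_def, smul_eq_mul, hcoe] at *
      linear_combination -h

lemma IsTraceFunction.translate_mem_orderedSpan {τ : G → C} (hτ : IsTraceFunction τ)
    {L : Subring C} {l : List G} (h₁ : ∀ a ∈ l, τ a ∈ L)
    (h₂ : ∀ a ∈ l, ∀ b ∈ l, τ (a * b) ∈ L) {g : G} (hg : g ∈ Subgroup.closure {a | a ∈ l}) :
    rightTranslation L g τ ∈ orderedSpan L τ l := by
  have hcomp : ∀ a b : G, rightTranslation L (a * b) τ =
      rightTranslation L a (rightTranslation L b τ) := fun a b => by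
    ext x; simp [mul_assoc]
  induction hg using Subgroup.closure_induction_left with
  | one =>
    convert self_mem_orderedSpan L τ l
    ext x; simp
  | mul_left a ha b _ ih =>
    rw [hcomp]
    exact hτ.rightTranslation_mem_orderedSpan h₁ h₂ ha ih
  | inv_mul_cancel a ha b _ ih =>
    rw [hcomp]
    have h : rightTranslation L a⁻¹ (rightTranslation L b τ) =
        (⟨τ a, h₁ a ha⟩ : L) • rightTranslation L b τ -
          rightTranslation L a (rightTranslation L b τ) := by
      ext x
      exact (hτ.satisfiesTraceIdentity_of_mem_orderedSpan L ih).translate_inv a x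
    rw [h]
    exact sub_mem (Submodule.smul_mem _ _ ih) (hτ.rightTranslation_mem_orderedSpan h₁ h₂ ha ih)

lemma apply_mem_of_mem_orderedSpan {τ : G → C} {L : Subring C} {l : List G} (y : G)
    (h : ∀ m ∈ l.sublists', τ (y * m.prod) ∈ L) {ψ : G → C} (hψ : ψ ∈ orderedSpan L τ l) :
    ψ y ∈ L := by
  induction l generalizing y ψ with
  | nil =>
    obtain ⟨c, rfl⟩ := Submodule.mem_span_singleton.1 hψ
    exact L.mul_mem c.2 (by simpa using h)
  | cons a l ih =>
    obtain ⟨φ₁, h₁, φ₂, h₂, rfl⟩ := mem_orderedSpan_cons.1 hψ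
    refine L.add_mem (ih y (fun m hm => h m ?_) h₁) (ih (y * a) (fun m hm => ?_) h₂)
    · simp only [List.sublists'_cons, List.mem_append]
      exact Or.inl hm
    · have := h (a :: m) (by simpa using Or.inr (List.mem_sublists'.1 hm))
      rwa [List.prod_cons, ← mul_assoc] at this

/-- Trace functions on a finitely generated group are integral polynomials in finitely many of
their values. -/
lemma exists_finset_forall_mem_adjoin (G : Type*) [Group G] [Group.FG G] :
    ∃ F : Finset G, ∀ {C : Type*} [CommRing C] {τ : G → C}, IsTraceFunction τ →
      ∀ g, τ g ∈ Algebra.adjoin ℤ (Set.range fun x : F => τ x) := by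
  classical
  obtain ⟨n, s, -, hs⟩ := Group.fg_iff'.1 ‹Group.FG G›
  let l := s.toList
  -- Sublist products supply the spanning values; generators and their pairwise products supply the
  -- coefficients.
  refine ⟨(l.sublists'.map List.prod).toFinset ∪ (s ∪ (s ×ˢ s).image fun p => p.1 * p.2),
    fun {C _ τ} hτ g => ?_⟩
  set F := (l.sublists'.map List.prod).toFinset ∪ (s ∪ (s ×ˢ s).image fun p => p.1 * p.2) with hF
  let L : Subring C := (Algebra.adjoin ℤ (Set.range fun x : F => τ x)).toSubring
  have hL : ∀ x ∈ F, τ x ∈ L := fun x hx => Algebra.subset_adjoin ⟨⟨x, hx⟩, rfl⟩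
  have hmem : rightTranslation L g τ ∈ orderedSpan L τ l := by
    refine hτ.translate_mem_orderedSpan (fun a ha => hL a ?_) (fun a ha b hb => hL _ ?_) ?_
    · simp [hF, Finset.mem_toList.1 ha]
    · simp only [hF, Finset.mem_union, Finset.mem_image, Finset.mem_product]
      exact Or.inr (Or.inr ⟨(a, b), ⟨Finset.mem_toList.1 ha, Finset.mem_toList.1 hb⟩, rfl⟩)
    · have : {a | a ∈ l} = (s : Set G) := by ext; simp [l]
      rw [this, hs]
      trivial
  have h := apply_mem_of_mem_orderedSpan 1 (fun m hm => hL _ ?_) hmem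
  · rwa [rightTranslation_apply, one_mul] at h
  · rw [one_mul, hF, Finset.mem_union, List.mem_toFinset]
    exact Or.inl (List.mem_map_of_mem hm)

end FiniteGeneration

/-! ### Realizing trace functions by representations -/

section Realization

variable {G K : Type*} [Group G] [Field K]

/-- A trace form on an algebra which is multiplicative on the corners of two complementary
elements `e`, `e'` is the trace of a two-dimensional representation: there are off-diagonal
entries `α`, `β` completing the diagonal entries `T (e x)`, `T (e' x)`. -/
lemma exists_offDiagonal {A : Type*} [Ring A] [Algebra K A] (T : A →ₗ[K] K)
    (hT : ∀ x y, T (x * y) = T (y * x)) {e e' : A} (hadd : e + e' = 1)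
    (he : ∀ x y, T (e * (x * (e * y))) = T (e * x) * T (e * y))
    (he' : ∀ x y, T (e' * (x * (e' * y))) = T (e' * x) * T (e' * y))
    (h1 : T e = 1) (h1' : T e' = 1) :
    ∃ α β : A →ₗ[K] K,
      (∀ x y, T (e * (x * y)) = T (e * x) * T (e * y) + α x * β y) ∧
      (∀ x y, α (x * y) = T (e * x) * α y + α x * T (e' * y)) ∧
      (∀ x y, β (x * y) = β x * T (e * y) + T (e' * x) * β y) ∧
      (∀ x y, T (e' * (x * y)) = β x * α y + T (e' * x) * T (e' * y)) ∧
      α 1 = 0 ∧ β 1 = 0 ∧ ∀ x, (∀ y, T (x * y) = 0) → α x = 0 ∧ β x = 0 := by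
  have hsplit : ∀ x y, x * y = x * (e * y) + x * (e' * y) := fun x y => by
    rw [← mul_add, ← add_mul, hadd, one_mul]
  have hcyc : ∀ x y, T (e' * (x * (e * y))) = T (e * (y * (e' * x))) := fun x y => by
    rw [← mul_assoc, hT, mul_assoc]
  -- Under `T`, `e` and `e'` act as orthogonal idempotents: `he` at `x = 1` gives T(eez) = T(ez).
  have hzero : ∀ z, T (e * (e' * z)) = 0 := fun z => by
    have h := he 1 z
    rw [one_mul, mul_one, h1, one_mul] at h
    have h' := hsplit 1 z
    rw [one_mul, one_mul, one_mul] at h'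
    have h'' := congrArg (fun t => T (e * t)) h'
    simp only [mul_add, map_add] at h''
    linear_combination h'' * (-1) - h
  have hzero' : ∀ z, T (e' * (e * z)) = 0 := fun z => by
    have h := he' 1 z
    rw [one_mul, mul_one, h1', one_mul] at h
    have h' := hsplit 1 z
    rw [one_mul, one_mul, one_mul] at h'
    have h'' := congrArg (fun t => T (e' * t)) h'
    simp only [mul_add, map_add] at h''
    linear_combination h'' * (-1) - h
  by_cases hD : ∀ x y, T (e * (x * (e' * y))) = 0
  · refine ⟨0, 0, fun x y => ?_, by simp, by simp, fun x y => ?_, by simp, by simp, by simp⟩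
    · rw [hsplit x y, mul_add, map_add, he, hD]
      simp
    · rw [hsplit x y, mul_add, map_add, he', hcyc, hD]
      simp
  push Not at hD
  obtain ⟨z, w, hzw⟩ := hD
  -- The pairing T(e x e' y) has rank one: `he` merges the two factors, and after cyclic rotation
  -- `he'` splits them differently. The row and column through the nonzero entry at (z, w) then give
  -- `β` and `α`.
  have hminor : ∀ x y, T (e * (x * (e' * y))) * T (e * (z * (e' * w))) =
      T (e * (x * (e' * w))) * T (e * (z * (e' * y))) := fun x y => by
    have h₁ := he (x * (e' * y)) (z * (e' * w))
    have h₂ := he' (y * (e * z)) (w * (e * x))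
    have h₃ := hT (e * x) (e' * (y * (e * (z * (e' * w)))))
    have h₄ := hcyc y z
    have h₅ := hcyc w x
    simp only [mul_assoc] at *
    rw [← h₁, h₃, h₂, h₄, h₅, mul_comm]
  let β : A →ₗ[K] K := T ∘ₗ LinearMap.mulLeft K (e * (z * e'))
  let α : A →ₗ[K] K :=
    (T (e * (z * (e' * w))))⁻¹ • (T ∘ₗ LinearMap.mulLeft K e ∘ₗ LinearMap.mulRight K (e' * w))
  have hβ : ∀ y, β y = T (e * (z * (e' * y))) := fun y => by simp [β]
  have hα : ∀ x, α x = (T (e * (z * (e' * w))))⁻¹ * T (e * (x * (e' * w))) := fun x => by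
    simp [α, mul_assoc]
  have hαβ : ∀ x y, T (e * (x * (e' * y))) = α x * β y := fun x y => by
    rw [hα, hβ]
    field_simp
    exact hminor x y
  refine ⟨α, β, fun x y => ?_, fun x y => ?_, fun x y => ?_, fun x y => ?_, ?_, ?_,
    fun x hx => ⟨?_, ?_⟩⟩
  · rw [hsplit x y, mul_add, map_add, he, hαβ]
  · have h₁ := he x (y * (e' * w))
    have h₂ := he' y (w * (e * x))
    have h₃ := hT (e * x) (e' * (y * (e' * w)))
    have h₄ := hcyc w x
    have h₅ := hsplit x (y * (e' * w))
    rw [hα, hα, hα, mul_assoc, h₅, mul_add, map_add, h₁]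
    simp only [mul_assoc] at *
    rw [h₃, h₂, h₄]
    ring
  · have h₁ := he (z * (e' * x)) y
    have h₂ := he' x (y * (e * z))
    have h₃ := hT (e * z) (e' * (x * (e' * y)))
    have h₄ := hcyc y z
    rw [hβ, hβ, hβ, hsplit x y, mul_add, mul_add, mul_add, map_add]
    simp only [mul_assoc] at *
    rw [h₁, h₃, h₂, h₄]
  · rw [hsplit x y, mul_add, map_add, he', hcyc, hαβ]
    ring
  · rw [hα, one_mul, hzero, mul_zero]
  · rw [hβ, mul_one, ← mul_assoc, hT, hzero']
  · rw [hα, hT e (x * _), mul_assoc, hx, mul_zero]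
  · rw [hβ, ← mul_assoc, ← mul_assoc, hT, hx]

/-- A multiplicative family of `2 × 2` matrices whose trace is a trace function, and for which
`M g + M g⁻¹` is the scalar `τ g`, gives a character. -/
lemma mem_characterVariety_of_matrix {τ : G → K} (M : G → Matrix (Fin 2) (Fin 2) K)
    (hone : M 1 = 1) (hmul : ∀ g h, M (g * h) = M g * M h) (htr : ∀ g, (M g).trace = τ g)
    (hinv : ∀ g, M g + M g⁻¹ = τ g • (1 : Matrix (Fin 2) (Fin 2) K)) :
    τ ∈ characterVariety G K := by
  have hdet : ∀ g, (M g).det = 1 := fun g => by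
    -- Since tr(M) − M is the adjugate of a 2 × 2 matrix M, M(g)M(g⁻¹) = 1 forces determinant 1.
    have hadj : M g⁻¹ = (M g).adjugate := by
      have h := hinv g
      rw [← eq_sub_iff_add_eq'] at h
      rw [h, ← htr g, Matrix.adjugate_fin_two]
      ext i j
      fin_cases i <;> fin_cases j <;> simp [Matrix.trace_fin_two]
    have h := hmul g g⁻¹
    rw [mul_inv_cancel, hone, hadj, Matrix.mul_adjugate] at h
    simpa using (congrFun (congrFun h 0) 0).symm
  refine ⟨⟨⟨fun g => ⟨M g, hdet g⟩, Subtype.ext hone⟩, fun g h => Subtype.ext (hmul g h)⟩, ?_⟩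
  exact funext htr

/-- The linear extension of a function on a group to the group algebra. -/
noncomputable def groupAlgebraExtension (τ : G → K) : MonoidAlgebra K G →ₗ[K] K :=
  Finsupp.linearCombination K τ ∘ₗ (MonoidAlgebra.coeffLinearEquiv K).toLinearMap

@[simp] lemma groupAlgebraExtension_of (τ : G → K) (g : G) :
    groupAlgebraExtension τ (MonoidAlgebra.of K G g) = τ g := by
  simp [groupAlgebraExtension]

lemma IsTraceFunction.groupAlgebraExtension_mul_comm {τ : G → K} (hτ : IsTraceFunction τ)
    (x y : MonoidAlgebra K G) :
    groupAlgebraExtension τ (x * y) = groupAlgebraExtension τ (y * x) := by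
  induction x using MonoidAlgebra.induction_on with
  | of g =>
    induction y using MonoidAlgebra.induction_on with
    | of h => simp only [← map_mul, groupAlgebraExtension_of, hτ.map_mul_comm g h]
    | add x y hx hy => rw [mul_add, add_mul, map_add, map_add, hx, hy]
    | smul r x hx => rw [mul_smul_comm, smul_mul_assoc, map_smul, map_smul, hx]
  | add x y hx hy => rw [mul_add, add_mul, map_add, map_add, hx, hy]
  | smul r x hx => rw [mul_smul_comm, smul_mul_assoc, map_smul, map_smul, hx]

/-- In a representation, g − μ is singular, hence of rank at most one, say uvᵗ, and tr(uvᵗx uvᵗy) =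
tr(uvᵗx) tr(uvᵗy). The trace identities alone imply this. -/
lemma IsTraceFunction.groupAlgebraExtension_corner {τ : G → K} (hτ : IsTraceFunction τ) {g : G}
    {μ : K} (hμ : μ ^ 2 - τ g * μ + 1 = 0) (c : K) {e : MonoidAlgebra K G}
    (he : e = c • (MonoidAlgebra.of K G g - μ • 1))
    (x y : MonoidAlgebra K G) :
    groupAlgebraExtension τ (e * (x * (e * y))) =
      groupAlgebraExtension τ (e * x) * groupAlgebraExtension τ (e * y) := by
  have hof : ∀ h, groupAlgebraExtension τ (e * MonoidAlgebra.of K G h) =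
      c * (τ (g * h) - μ * τ h) := fun h => by
    rw [he, smul_mul_assoc, sub_mul, smul_mul_assoc, one_mul, ← map_mul, map_smul, map_sub,
      map_smul, groupAlgebraExtension_of, groupAlgebraExtension_of, smul_eq_mul, smul_eq_mul]
  induction x using MonoidAlgebra.induction_on with
  | of h =>
    induction y using MonoidAlgebra.induction_on with
    | of k =>
      have hl : groupAlgebraExtension τ
          (e * (MonoidAlgebra.of K G h * (e * MonoidAlgebra.of K G k))) =
          c * (c * (τ (g * (h * (g * k))) - μ * τ (h * (g * k))) -
            μ * (c * (τ (g * (h * k)) - μ * τ (h * k)))) := by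
        have h' : e * (MonoidAlgebra.of K G h * (e * MonoidAlgebra.of K G k)) =
            c • (e * MonoidAlgebra.of K G (h * (g * k)) -
              μ • (e * MonoidAlgebra.of K G (h * k))) := by
          nth_rewrite 2 [he]
          simp only [smul_mul_assoc, mul_smul_comm, sub_mul, mul_sub, one_mul, map_mul]
        rw [h', map_smul, map_sub, map_smul, hof, hof, smul_eq_mul, smul_eq_mul]
      have h₁ := hτ.map_mul_add (g * h) (g * k)
      have h₂ := hτ.map_mul_add (g * h) k
      have h₃ := hτ.map_mul_add h (g * k)
      have h₄ := hτ.map_mul_add h k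
      have h₅ := hτ.map_mul_add (h * k⁻¹) g
      have h₆ := hτ.map_mul_comm g (h * k⁻¹)
      have h₇ := hτ.map_mul_comm g (h * (k⁻¹ * g⁻¹))
      simp only [mul_inv_rev, mul_assoc, inv_mul_cancel, mul_one] at h₁ h₂ h₃ h₄ h₅ h₆ h₇
      rw [hl, hof, hof]
      linear_combination c ^ 2 * (h₁ - μ * h₂ - μ * h₃ + μ ^ 2 * h₄ + μ * h₅ + μ * h₆ - h₇
        - τ (h * k⁻¹) * hμ)
    | add x y hx hy => simp only [mul_add, map_add, hx, hy]
    | smul r x hx =>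
      simp only [mul_smul_comm, map_smul, hx, smul_eq_mul]
      ring
  | add x y hx hy => simp only [mul_add, add_mul, map_add, hx, hy]
  | smul r x hx =>
    simp only [mul_smul_comm, smul_mul_assoc, map_smul, hx, smul_eq_mul]
    ring

lemma IsTraceFunction.mem_characterVariety_of_sq_eq_four {τ : G → K} (hτ : IsTraceFunction τ)
    (hsq : ∀ g, τ g ^ 2 = 4) : τ ∈ characterVariety G K := by
  classical
  let ε : G → K := fun g => if τ g = 2 then 1 else -1
  have hε : ∀ g, ε g = 1 ∨ ε g = -1 := fun g => by
    by_cases h : τ g = 2 <;> simp [ε, h]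
  have hτε : ∀ g, τ g = 2 * ε g := fun g => by
    by_cases h : τ g = 2
    · simp [ε, h]
    · have h' : (τ g - 2) * (τ g + 2) = 0 := by linear_combination hsq g
      simp only [ε, h, if_false]
      linear_combination (mul_eq_zero.1 h').resolve_left (sub_ne_zero.2 h)
  have hmul : ∀ g h, ε (g * h) = ε g * ε h := fun g h => by
    have hadd := hτ.map_mul_add g h
    simp only [hτε] at hadd
    -- In characteristic 2 all signs agree; otherwise an inconsistent choice of signs would give 4 =
    -- 0 or 8 = 0.
    by_cases h2 : (2 : K) = 0
    · have hone : ∀ g, ε g = 1 := fun g => (hε g).elim id fun h => by linear_combination h - h2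
      rw [hone, hone, hone, one_mul]
    · have h4 : (2 : K) ^ 2 ≠ 0 := pow_ne_zero 2 h2
      have h8 : (2 : K) ^ 3 ≠ 0 := pow_ne_zero 3 h2
      rcases hε (g * h) with h₁ | h₁ <;> rcases hε (g * h⁻¹) with h₂ | h₂ <;>
        rcases hε g with h₃ | h₃ <;> rcases hε h with h₅ | h₅ <;>
        rw [h₁, h₂, h₃, h₅] at hadd <;> rw [h₁, h₃, h₅] <;>
        first
        | ring1
        | exact absurd (by linear_combination hadd) h4
        | exact absurd (by linear_combination -hadd) h4
        | exact absurd (by linear_combination hadd) h8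
        | exact absurd (by linear_combination -hadd) h8
  refine mem_characterVariety_of_matrix (fun g => ε g • 1) ?_ (fun g h => ?_) (fun g => ?_)
    (fun g => ?_)
  · simp [ε, hτ.map_one]
  · simp [hmul, smul_smul, mul_comm]
  · simp [hτε, mul_comm]
  · have h : ε g⁻¹ = ε g := by simp only [ε, hτ.map_inv]
    rw [h, ← add_smul, hτε, two_mul]

lemma IsTraceFunction.mem_characterVariety (hK : IsQuadraticallyClosed K) {τ : G → K}
    (hτ : IsTraceFunction τ) : τ ∈ characterVariety G K := by
  by_cases hsq : ∀ g, τ g ^ 2 = 4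
  · exact hτ.mem_characterVariety_of_sq_eq_four hsq
  · push Not at hsq
    obtain ⟨g, hg⟩ := hsq
    obtain ⟨μ, hμ⟩ := hK (-τ g) 1
    -- The eigenvalues μ and τ(g) − μ are distinct, as (τ(g) − 2μ)² = τ(g)² − 4.
    have hδ : τ g - 2 * μ ≠ 0 := fun h => hg (by linear_combination (τ g - 2 * μ) * h - 4 * hμ)
    set c := (τ g - 2 * μ)⁻¹
    have hcδ : c * (τ g - 2 * μ) = 1 := inv_mul_cancel₀ hδ
    set e : MonoidAlgebra K G := c • (MonoidAlgebra.of K G g - μ • 1) with he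
    set e' : MonoidAlgebra K G := (-c) • (MonoidAlgebra.of K G g - (τ g - μ) • 1) with he'
    set T := groupAlgebraExtension τ with hT
    have hT1 : T 1 = 2 := by
      rw [← _root_.map_one (MonoidAlgebra.of K G), hT, groupAlgebraExtension_of, hτ.map_one]
    have hadd : e + e' = 1 := by
      have h : e + e' = (c * (τ g - 2 * μ)) • (1 : MonoidAlgebra K G) := by
        rw [he, he']; module
      rw [h, hcδ, one_smul]
    have h1 : T e = 1 := by
      rw [he, map_smul, map_sub, map_smul, hT1, hT, groupAlgebraExtension_of, smul_eq_mul,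
        smul_eq_mul, mul_comm μ, hcδ]
    have h1' : T e' = 1 := by
      have h := congrArg T hadd
      rw [map_add, h1, hT1] at h
      linear_combination h
    obtain ⟨α, β, h₁₁, h₁₂, h₂₁, h₂₂, hα, hβ, hrad⟩ := exists_offDiagonal T
      hτ.groupAlgebraExtension_mul_comm hadd
      (hτ.groupAlgebraExtension_corner (by linear_combination hμ) c he)
      (hτ.groupAlgebraExtension_corner (by linear_combination hμ) (-c) he')
      h1 h1'
    -- x + x⁻¹ − τ(x) lies in the radical of the trace form, where `α` and `β` vanish.
    have hker : ∀ (x : G) (y : MonoidAlgebra K G), T ((MonoidAlgebra.of K G x +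
        MonoidAlgebra.of K G x⁻¹ - τ x • 1) * y) = 0 := fun x y => by
      induction y using MonoidAlgebra.induction_on with
      | of h =>
        have h₁ := hτ.map_mul_add h x
        rw [hτ.map_mul_comm h x, hτ.map_mul_comm h x⁻¹] at h₁
        rw [sub_mul, add_mul, smul_mul_assoc, one_mul, ← map_mul, ← map_mul, map_sub, map_add,
          map_smul, hT, groupAlgebraExtension_of, groupAlgebraExtension_of,
          groupAlgebraExtension_of, smul_eq_mul]
        linear_combination h₁
      | add y z hy hz => rw [mul_add, map_add, hy, hz, add_zero]
      | smul r y hy => rw [mul_smul_comm, map_smul, hy, smul_zero]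
    have hcorner : ∀ (x : G) (a : MonoidAlgebra K G), T (a * MonoidAlgebra.of K G x) +
        T (a * MonoidAlgebra.of K G x⁻¹) = τ x * T a := fun x a => by
      have h := hker x a
      rw [hT, hτ.groupAlgebraExtension_mul_comm, ← hT, mul_sub, mul_add, mul_smul_comm, mul_one,
        map_sub, map_add, map_smul, smul_eq_mul] at h
      linear_combination h
    refine mem_characterVariety_of_matrix (fun x =>
      !![T (e * MonoidAlgebra.of K G x), α (MonoidAlgebra.of K G x);
        β (MonoidAlgebra.of K G x), T (e' * MonoidAlgebra.of K G x)]) ?_ (fun x y => ?_)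
      (fun x => ?_) (fun x => ?_)
    · rw [_root_.map_one, mul_one, mul_one, h1, h1', hα, hβ, Matrix.one_fin_two]
    · rw [(MonoidAlgebra.of K G).map_mul, h₁₁, h₁₂, h₂₁, h₂₂, Matrix.mul_fin_two]
    · rw [Matrix.trace_fin_two_of, ← map_add, ← add_mul, hadd, one_mul, hT,
        groupAlgebraExtension_of]
    · obtain ⟨h₁, h₂⟩ := hrad _ (hker x)
      rw [map_sub, map_add, map_smul, hα, smul_zero, sub_zero] at h₁
      rw [map_sub, map_add, map_smul, hβ, smul_zero, sub_zero] at h₂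
      have h₃ := hcorner x e
      have h₄ := hcorner x e'
      rw [h1, mul_one] at h₃
      rw [h1', mul_one] at h₄
      ext i j
      fin_cases i <;> fin_cases j <;> simpa

end Realization

/-! ### Equations of the character variety -/

lemma isTraceFunction_of_mem_characterVariety {G K : Type*} [Group G] [Field K] {χ : G → K}
    (hχ : χ ∈ characterVariety G K) : IsTraceFunction χ := by
  obtain ⟨ρ, rfl⟩ := hχ
  refine ⟨by simp [sl2Character], fun g h => ?_⟩
  simp only [sl2Character, map_mul, map_inv, Matrix.SpecialLinearGroup.coe_mul,
    Matrix.SpecialLinearGroup.coe_inv, Matrix.adjugate_fin_two, Matrix.trace_fin_two,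
    Matrix.mul_apply, Fin.sum_univ_two]
  simp
  ring

/-- Every set of integral polynomials in finitely many variables has the same zeros as a finite
one. -/
lemma exists_finset_integralZeroSet_eq {σ : Type*} [Finite σ] (K : Type*) [Field K]
    (s : Set (MvPolynomial σ ℤ)) :
    ∃ S : Finset (MvPolynomial σ ℤ),
      integralZeroSet K S = {t | ∀ p ∈ s, MvPolynomial.aeval t p = 0} := by
  obtain ⟨S, hS⟩ := (isNoetherianRing_iff_ideal_fg _).1 inferInstance (Ideal.span s)
  refine ⟨S, ?_⟩
  have key : ∀ (u : Set (MvPolynomial σ ℤ)) (t : σ → K),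
      (∀ p ∈ u, MvPolynomial.aeval t p = 0) ↔
        Ideal.span u ≤ RingHom.ker (MvPolynomial.aeval (R := ℤ) t) := fun u t => by
    rw [Ideal.span_le]; rfl
  ext t
  have h₁ := key S t
  have h₂ := key s t
  have hS' : Ideal.span (S : Set (MvPolynomial σ ℤ)) = Ideal.span s := hS
  rw [hS', ← h₂] at h₁
  exact h₁

theorem mainTheorem4 {G : Type*} [Group G] [Group.FG G] {K : Type*} [Field K]
    (hK : IsQuadraticallyClosed K) :
    ∃ (F : Finset G) (S : Finset (MvPolynomial F ℤ)),
      Set.BijOn (restrictTo F) (characterVariety G K) (integralZeroSet K S) ∧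
      ∀ g : G, ∃ P : MvPolynomial F ℤ, ∀ χ ∈ characterVariety G K,
        χ g = MvPolynomial.aeval (restrictTo F χ) P := by
  obtain ⟨F, hF⟩ := exists_finset_forall_mem_adjoin G
  have hP : ∀ g : G, ∃ P : MvPolynomial F ℤ, ∀ χ ∈ characterVariety G K,
      χ g = MvPolynomial.aeval (restrictTo F χ) P := fun g => by
    -- Taking values in the ring of functions on the variety yields one polynomial valid for all χ
    -- at once.
    have hτ : IsTraceFunction fun (g : G) (χ : characterVariety G K) => χ.1 g :=
      ⟨funext fun χ => (isTraceFunction_of_mem_characterVariety χ.2).map_one,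
        fun g h => funext fun χ => (isTraceFunction_of_mem_characterVariety χ.2).map_mul_add g h⟩
    have hg := hF hτ g
    rw [Algebra.adjoin_range_eq_range_aeval] at hg
    obtain ⟨P, hP⟩ := hg
    refine ⟨P, fun χ hχ => ?_⟩
    have h := congrFun hP ⟨χ, hχ⟩
    have hcomp := MvPolynomial.map_aeval
      (fun x : F => fun χ : characterVariety G K => χ.1 x)
      (Pi.evalRingHom (fun _ => K) (⟨χ, hχ⟩ : characterVariety G K)) P
    exact h.symm.trans hcomp
  choose P hP' using hP
  -- The first two families make g ↦ P_g(t) a trace function; the last makes it restrict to t on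
  -- `F`.
  obtain ⟨S, hS⟩ := exists_finset_integralZeroSet_eq K
    ({P 1 - 2} ∪ (Set.range fun p : G × G => P (p.1 * p.2) + P (p.1 * p.2⁻¹) - P p.1 * P p.2) ∪
      Set.range fun x : F => P x - MvPolynomial.X x)
  refine ⟨F, S, ⟨fun χ hχ => ?_, fun χ hχ ψ hψ h => ?_, fun t ht => ?_⟩, fun g => ⟨P g, hP' g⟩⟩
  · have hτ := isTraceFunction_of_mem_characterVariety hχ
    rw [hS]
    rintro p ((rfl | ⟨q, rfl⟩) | ⟨x, rfl⟩)
    · simp [← hP' _ χ hχ, hτ.map_one]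
    · simp [← hP' _ χ hχ, hτ.map_mul_add]
    · simp [← hP' _ χ hχ, restrictTo]
  · funext g
    rw [hP' g χ hχ, hP' g ψ hψ, h]
  · rw [hS] at ht
    have hτ : IsTraceFunction fun g => MvPolynomial.aeval t (P g) := by
      refine ⟨?_, fun g h => ?_⟩
      · simpa [sub_eq_zero] using ht (P 1 - 2) (Or.inl (Or.inl rfl))
      · simpa [sub_eq_zero] using ht _ (Or.inl (Or.inr ⟨(g, h), rfl⟩))
    refine ⟨_, hτ.mem_characterVariety hK, funext fun x => ?_⟩
    have h := ht _ (Or.inr ⟨x, rfl⟩)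
    rwa [map_sub, MvPolynomial.aeval_X, sub_eq_zero] at h
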